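/- A permutation $\pi$ of $\{1,\dots,n\}$ contains a permutation $\tau$ of $\{1,\dots,k\}$ if some subsequence of $\pi_1\cdots\pi_n$ is order-isomorphic to $\tau$, and avoids $\tau$ otherwise; $\pi$ is even if its number of inversions is even. For a pattern $\tau$ let $$I_\tau(x)=\sum_{n\ge0}I_\tau(n)x^n,\qquad I^e_\tau(x)=\sum_{n\ge0}I^e_\tau(n)x^n,$$ where $I_\tau(n)$ (resp. $I^e_\tau(n)$) is the number of involutions (resp. even involutions) of $\{1,\dots,n\}$ that avoid both $132$ and $\tau$. Let $U_r$ be the Chebyshev polynomials of the second kind ($U_{-1}=0$, $U_0=1$, $U_1(t)=2t$, $U_r(t)=2tU_{r-1}(t)-U_{r-2}(t)$), and for $r\ge0$ let $$R_r(y)=\frac{U_{r-1}\left(\frac1{2\sqrt y}\right)}{\sqrt y\,U_r\left(\frac1{2\sqrt y}\right)},\qquad R^e_r(y)=\tfrac12\bigl(R_r(y)+R_r(-y)\bigr),$$ so that $R_0=0$ and $R_r$ is a rational function of $y$. For $1\le d\le k/2$ put $\langle k,d\rangle=(d+1,d+2,\dots,k,1,2,\dots,d)$. **Theorem.** For all integers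 $k,d$ with $1\le d\le k/2$, $$I^e_{\langle k,d\rangle}(x)=\frac{R_d(-x^2)}{1-xR_d(-x^2)}\Bigl(1+x^2\bigl(R_{d-1}(-x^2)-R_{k-d-1}(-x^2)\bigr)I^e_{12\dots(k-d)}(x)+x^2\bigl(R^e_{k-d-1}(x^2)-R^e_{d-1}(x^2)\bigr)I_{12\dots(k-d)}(x)+x^2R^e_{d-1}(x^2)\,I_{\langle k,d\rangle}(x)\Bigr),$$ where $$I_{12\dots(k-d)}(x)=\frac{1}{x\,U_{k-d}\left(\frac1{2x}\right)}\sum_{j=0}^{k-d-1}U_j\left(\frac1{2x}\right)$$ and $$I_{\langle k,d\rangle}(x)=\frac{R_d(x^2)}{1-xR_d(x^2)}\Bigl(1+x^2\bigl(R_{k-d-1}(x^2)-R_{d-1}(x^2)\bigr)I_{12\dots(k-d)}(x)\Bigr).$$ -/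

import Mathlib

noncomputable section

namespace RestrictedInvolutions

open Polynomial

/-- `π` contains `τ`: some subsequence of `π` is order-isomorphic to `τ`. -/
def Contains {n k : ℕ} (π : Equiv.Perm (Fin n)) (τ : Equiv.Perm (Fin k)) : Prop :=
  ∃ f : Fin k → Fin n, StrictMono f ∧ ∀ i j : Fin k, π (f i) < π (f j) ↔ τ i < τ j

/-- The number of inversions of `π`. -/
def inversions {n : ℕ} (π : Equiv.Perm (Fin n)) : ℕ :=
  (Finset.univ.filter fun p : Fin n × Fin n => p.1 < p.2 ∧ π p.2 < π p.1).card

/-- The pattern `132`. -/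
def pattern132 : Equiv.Perm (Fin 3) := Equiv.swap 1 2

/-- The pattern `12…l`. -/
def increasing (l : ℕ) : Equiv.Perm (Fin l) := 1

/-- The pattern `<k,d> = (d+1, d+2, …, k, 1, 2, …, d)`; written with the letters `0, …, k-1`
it is `i ↦ i + d mod k`, see `rotated_apply`. -/
def rotated (k d : ℕ) : Equiv.Perm (Fin k) := finRotate k ^ d

theorem rotated_apply (k d : ℕ) (i : Fin k) : (rotated k d i : ℕ) = (i + d) % k := by
  induction d with
  | zero => simp [rotated, Nat.mod_eq_of_lt i.isLt]
  | succ d ih =>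
    have h : rotated k (d + 1) i = finRotate k (rotated k d i) := by
      simp [rotated, pow_succ', Equiv.Perm.mul_apply]
    obtain _ | k := k
    · exact i.elim0
    · rw [h, finRotate_apply, Fin.val_add, ih, Fin.val_one', ← Nat.add_mod, Nat.add_assoc]

/-- The involutions of `n` letters that avoid both `132` and `τ`. -/
def avoidingInvolutions {k : ℕ} (τ : Equiv.Perm (Fin k)) (n : ℕ) : Set (Equiv.Perm (Fin n)) :=
  {π | π⁻¹ = π ∧ ¬ Contains π pattern132 ∧ ¬ Contains π τ}

/-- The fraction field of the ring of formal power series, that is, the field of formal Laurent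
series with finitely many negative exponents. -/
abbrev LaurentField : Type := FractionRing (PowerSeries ℂ)

instance : CharZero LaurentField :=
  charZero_of_injective_algebraMap (algebraMap ℂ LaurentField).injective

/-- A formal power series as an element of the field. -/
def ofSeries (f : PowerSeries ℂ) : LaurentField := algebraMap (PowerSeries ℂ) LaurentField f

/-- The indeterminate `x`. -/
def x : LaurentField := ofSeries PowerSeries.X

/-- `I_τ(x)`, the generating function of the involutions avoiding `132` and `τ`. -/
def genI {k : ℕ} (τ : Equiv.Perm (Fin k)) : LaurentField :=
  ofSeries (PowerSeries.mk fun n => ((avoidingInvolutions τ n).ncard : ℂ))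

/-- `I^e_τ(x)`, the generating function of the even involutions avoiding `132` and `τ`. -/
def genIe {k : ℕ} (τ : Equiv.Perm (Fin k)) : LaurentField :=
  ofSeries (PowerSeries.mk fun n =>
    ({π ∈ avoidingInvolutions τ n | Even (inversions π)}.ncard : ℂ))

/-- `U_{r-1}(1/(2s)) / (s U_r(1/(2s)))` with `U` the Chebyshev polynomials of the second kind
(`U_{-1} = 0`). -/
def chebQuot {K : Type*} [Field K] (r : ℕ) (s : K) : K :=
  (Chebyshev.U K ((r : ℤ) - 1)).eval (1 / (2 * s)) / (s * (Chebyshev.U K (r : ℤ)).eval (1 / (2 * s)))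

open Classical in
/-- `R_r(y) = U_{r-1}(1/(2√y)) / (√y U_r(1/(2√y)))`, for a `y` with a square root in the field `K`.
The choice of the square root does not matter, see `R_sq`. -/
def R {K : Type*} [Field K] (r : ℕ) (y : K) : K :=
  if h : ∃ s : K, s ^ 2 = y then chebQuot r h.choose else 0

theorem chebQuot_neg {K : Type*} [Field K] (r : ℕ) (s : K) : chebQuot r (-s) = chebQuot r s := by
  have e : (1 : K) / (2 * -s) = -(1 / (2 * s)) := by rw [mul_neg, div_neg]
  unfold chebQuot
  obtain _ | r := r
  · simp
  · have c : ((r + 1 : ℕ) : ℤ) - 1 = (r : ℤ) := by push_cast; ring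
    rw [e, c, Chebyshev.U_eval_neg, Chebyshev.U_eval_neg]
    rcases Int.even_or_odd (r : ℤ) with h | h
    · simp [Int.negOnePow_succ, Int.negOnePow_even _ h]
    · simp [Int.negOnePow_succ, Int.negOnePow_odd _ h, neg_div_neg_eq]

theorem R_sq {K : Type*} [Field K] (r : ℕ) (s : K) : R r (s ^ 2) = chebQuot r s := by
  have h : ∃ t : K, t ^ 2 = s ^ 2 := ⟨s, rfl⟩
  unfold R
  rw [dif_pos h]
  rcases sq_eq_sq_iff_eq_or_eq_neg.1 h.choose_spec with e | e
  · rw [e]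
  · rw [e, chebQuot_neg]

/-- `-x²` has a square root too. -/
theorem R_neg_x_sq (r : ℕ) :
    R r (-x ^ 2) = chebQuot r (algebraMap ℂ (LaurentField) Complex.I * x) := by
  rw [← R_sq, mul_pow, ← map_pow, Complex.I_sq, map_neg, map_one, neg_mul, one_mul]

/-- `R^e_r(y) = (R_r(y) + R_r(-y)) / 2`. -/
def Re {K : Type*} [Field K] (r : ℕ) (y : K) : K := 1 / 2 * (R r y + R r (-y))

end RestrictedInvolutions

end

/-!
A permutation avoiding `132` has the form `(a ⊕ 1) ⊖ b`, the new letter being the largest one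
(`exists_glue`). If it is an involution, then it is `s ⊕ 1` with an involution `s`, or an *arch*
`(α ⊕ 1) ⊖ β ⊖ (α⁻¹ ⊕ 1)` with an arbitrary `α` avoiding `132` and an involution `β`
(`exists_snoc_or_arch`).

Increasing subsequences do not leave a summand of a skew sum. Hence the arch contains `12…(m+1)` iff
`α` contains `12…m` or `β` contains `12…(m+1)`. The pattern `⟨k,d⟩` is `(12…(k-d)) ⊖ (12…d)`, and as
`d ≤ k - d`, the arch avoids it iff `α` avoids `12…(k-d-1)`, `β` avoids `⟨k,d⟩`, and either `α` avoids
`12…(d-1)` or `β` avoids `12…(k-d)` (`hasRot_arch`). The parity of the number of inversions of the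
arch is that of `β` plus the size of `α ⊕ 1` (`pow_invs_arch`).

Give each inversion the weight `ε = ±1`. With `C_r` the series of the permutations avoiding `132` and
`12…r` in the variable `εx²`, with `I_m` and `K` the weighted series of the involutions avoiding `132`
and `12…m`, respectively `⟨k,d⟩`, these decompositions say
* `C_{r+1} = 1 + εx² C_r C_{r+1}` (`permGF_succ`),
* `I_{m+1} = 1 + x I_m + εx² C_m I_{m+1}` (`invGF_incAvoiders_succ`),
* `K = 1 + x K + εx² (C_{d-1} K + (C_{k-d-1} - C_{d-1}) I_{k-d})` (`invGF_rotAvoiders_succ`).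

The first one is also the recurrence of the quotients of Chebyshev polynomials, so that
`C_r = R_r(εx²)` (`eval_U_ne_zero_and_chebQuot_eq`). The case `ε = 1` of the other two gives `I_m` and
`K`. The series of the even involutions is the mean of the series for `ε = 1` and `ε = -1`, and the
formula for it is a linear combination of the two recurrences for `K`; the signed `I_{k-d}` need not
be computed.
-/

namespace RestrictedInvolutions

/-! ### Permutations of all sizes, as functions on `ℕ` -/

/-- A permutation of `{0, …, n-1}` together with its size `n`. -/
abbrev SizedPerm : Type := Σ n : ℕ, Equiv.Perm (Fin n)

namespace SizedPerm

/-- The number of letters. -/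
abbrev size (t : SizedPerm) : ℕ := t.1

/-- A permutation together with its size. -/
abbrev ofPerm {n : ℕ} (π : Equiv.Perm (Fin n)) : SizedPerm := ⟨n, π⟩

/-- The word of a permutation as a function on `ℕ`; beyond the size it is the identity. -/
def val (t : SizedPerm) (i : ℕ) : ℕ := if h : i < t.size then (t.2 ⟨i, h⟩ : ℕ) else i

/-- The inverse permutation. -/
def inv (t : SizedPerm) : SizedPerm := ⟨t.1, t.2⁻¹⟩

/-- The permutation of `{0, …, n-1}` with a given word. -/
noncomputable def ofFun (n : ℕ) (f : ℕ → ℕ) (hf : ∀ i < n, f i < n)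
    (inj : ∀ i < n, ∀ j < n, f i = f j → i = j) : SizedPerm :=
  ⟨n, Equiv.ofBijective (fun i : Fin n => (⟨f i, hf i i.2⟩ : Fin n))
    (Finite.injective_iff_bijective.1 fun i j h =>
      Fin.ext (inj i i.2 j j.2 (by simpa using h)))⟩

@[simp] theorem size_ofFun (n f hf inj) : (ofFun n f hf inj).size = n := rfl

@[simp] theorem size_inv (t : SizedPerm) : t.inv.size = t.size := rfl

theorem val_ofFun {n f hf inj} {i : ℕ} (h : i < n) : (ofFun n f hf inj).val i = f i := by
  have h' : i < (ofFun n f hf inj).size := h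
  rw [val, dif_pos h']
  rfl

theorem val_of_le {t : SizedPerm} {i : ℕ} (h : t.size ≤ i) : t.val i = i := by
  rw [val, dif_neg (by omega)]

theorem val_fin (t : SizedPerm) (i : Fin t.size) : t.val i = t.2 i := by
  simp [val]

theorem val_lt (t : SizedPerm) {i : ℕ} (h : i < t.size) : t.val i < t.size := by
  rw [val, dif_pos h]; exact (t.2 _).2

theorem val_inv_val (t : SizedPerm) (i : ℕ) : t.inv.val (t.val i) = i := by
  by_cases h : i < t.size
  · have := val_lt t h
    rw [val, dif_pos (show t.val i < t.inv.size from this)]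
    have e : (⟨t.val i, this⟩ : Fin t.size) = t.2 ⟨i, h⟩ := by
      apply Fin.ext; simp [val, h]
    change ((t.2⁻¹ ⟨t.val i, this⟩ : Fin t.size) : ℕ) = i
    rw [e]; simp
  · rw [val_of_le (t := t) (by omega), val_of_le]; simp; omega

theorem inv_inv (t : SizedPerm) : t.inv.inv = t := by
  change (⟨t.1, t.2⁻¹⁻¹⟩ : SizedPerm) = t
  rw [_root_.inv_inv]

theorem val_val_inv (t : SizedPerm) (i : ℕ) : t.val (t.inv.val i) = i := by
  simpa only [inv_inv] using val_inv_val t.inv i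

theorem val_inj (t : SizedPerm) {i j : ℕ} (h : t.val i = t.val j) : i = j := by
  rw [← val_inv_val t i, h, val_inv_val]

theorem ext_val {s t : SizedPerm} (h : s.size = t.size)
    (hv : ∀ i < s.size, s.val i = t.val i) : s = t := by
  obtain ⟨n, σ⟩ := s
  obtain ⟨m, τ⟩ := t
  obtain rfl : n = m := h
  congr 1
  ext i
  simpa [val] using hv i i.2

/-- The permutation of no letters. -/
def empty : SizedPerm := ⟨0, 1⟩

@[simp] theorem size_empty : empty.size = 0 := rfl

theorem eq_empty {t : SizedPerm} (h : t.size = 0) : t = empty :=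
  ext_val h fun i hi => by omega

/-- The skew sum: the letters of `s`, made larger than those of `t`, followed by `t`. -/
noncomputable def skew (s t : SizedPerm) : SizedPerm :=
  ofFun (s.size + t.size) (fun i => if i < s.size then s.val i + t.size else t.val (i - s.size))
    (fun i hi => by
      split_ifs with h
      · have := val_lt s h; omega
      · have := val_lt t (i := i - s.size) (by omega); omega)
    (fun i hi j hj h => by
      split_ifs at h with h1 h2 h2
      · exact val_inj s (by omega)
      · have := val_lt t (i := j - s.size) (by omega); omega
      · have := val_lt t (i := i - s.size) (by omega); omega
      · have := val_inj t h; omega)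

@[simp] theorem size_skew (s t : SizedPerm) : (skew s t).size = s.size + t.size := rfl

theorem val_skew_left {s : SizedPerm} (t : SizedPerm) {i : ℕ} (h : i < s.size) :
    (skew s t).val i = s.val i + t.size := by
  rw [skew, val_ofFun (by omega), if_pos h]

theorem val_skew_right (s t : SizedPerm) (i : ℕ) (h : i < t.size) :
    (skew s t).val (s.size + i) = t.val i := by
  rw [skew, val_ofFun (by omega), if_neg (by omega)]; congr 1; omega

theorem val_skew_of_le (s t : SizedPerm) {i : ℕ} (h : s.size ≤ i) (h' : i < s.size + t.size) :
    (skew s t).val i = t.val (i - s.size) := by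
  rw [skew, val_ofFun (by omega), if_neg (by omega)]

/-- Append a new largest letter. -/
noncomputable def snoc (s : SizedPerm) : SizedPerm :=
  ofFun (s.size + 1) s.val
    (fun i hi => by
      rcases Nat.lt_or_ge i s.size with h | h
      · have := val_lt s h; omega
      · rw [val_of_le h]; omega)
    (fun i _ j _ h => val_inj s h)

@[simp] theorem size_snoc (s : SizedPerm) : (snoc s).size = s.size + 1 := rfl

@[simp] theorem val_snoc (s : SizedPerm) (i : ℕ) : (snoc s).val i = s.val i := by
  rcases Nat.lt_or_ge i (s.size + 1) with h | h
  · rw [snoc, val_ofFun h]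
  · rw [val_of_le (by simpa using h), val_of_le (by omega)]

/-- The permutation whose largest letter has the letters of `s` in front of it and those of `t`
behind it, the former above the latter. -/
noncomputable def glue (s t : SizedPerm) : SizedPerm := skew (snoc s) t

/-- The involution `(α ⊕ 1) ⊖ β ⊖ (α⁻¹ ⊕ 1)` built from a permutation `α` and an involution `β`. -/
noncomputable def arch (α β : SizedPerm) : SizedPerm := skew (snoc α) (skew β (snoc α.inv))

@[simp] theorem size_glue (s t : SizedPerm) : (glue s t).size = s.size + 1 + t.size := rfl

@[simp] theorem size_arch (α β : SizedPerm) :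
    (arch α β).size = α.size + 1 + (β.size + (α.size + 1)) := rfl

theorem val_glue_left {s : SizedPerm} (t : SizedPerm) {i : ℕ} (h : i ≤ s.size) :
    (glue s t).val i = s.val i + t.size := by
  rw [glue, val_skew_left t (by simp; omega), val_snoc]

theorem val_glue_right (s t : SizedPerm) {i : ℕ} (h : i < t.size) :
    (glue s t).val (s.size + 1 + i) = t.val i := val_skew_right (snoc s) t i h

theorem val_arch_left {α : SizedPerm} (β : SizedPerm) {i : ℕ} (h : i ≤ α.size) :
    (arch α β).val i = α.val i + (β.size + (α.size + 1)) := by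
  rw [arch, val_skew_left _ (by simp; omega), val_snoc]; rfl

theorem val_arch_mid (α : SizedPerm) {β : SizedPerm} {i : ℕ} (h : i < β.size) :
    (arch α β).val (α.size + 1 + i) = β.val i + (α.size + 1) := by
  have := val_skew_right (snoc α) (skew β (snoc α.inv)) i (by simp; omega)
  rw [arch]
  exact this.trans (val_skew_left _ h)

theorem val_arch_right (α β : SizedPerm) {i : ℕ} (h : i ≤ α.size) :
    (arch α β).val (α.size + 1 + (β.size + i)) = α.inv.val i := by
  have := val_skew_right (snoc α) (skew β (snoc α.inv)) (β.size + i) (by simp; omega)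
  rw [arch]
  refine this.trans ?_
  rw [val_skew_right _ _ _ (by simp; omega), val_snoc]

/-- The size of `s` can be read off from `glue s t` as the position of the largest letter. -/
theorem glue_injective {s t s' t' : SizedPerm} (h : glue s t = glue s' t') :
    s = s' ∧ t = t' := by
  have hsz : s.size + 1 + t.size = s'.size + 1 + t'.size := by
    rw [← size_glue, ← size_glue, h]
  have h1 : (glue s t).val s.size = s.size + t.size := by
    rw [val_glue_left t le_rfl, val_of_le le_rfl]
  have h2 : (glue s t).val s'.size = s'.size + t'.size := by
    rw [h, val_glue_left t' le_rfl, val_of_le le_rfl]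
  have hs : s.size = s'.size := val_inj (glue s t) (by omega)
  have ht : t.size = t'.size := by omega
  constructor
  · refine ext_val hs fun i hi => ?_
    have := val_glue_left t (s := s) (i := i) hi.le
    rw [h, val_glue_left t' (by omega)] at this
    omega
  · refine ext_val ht fun i hi => ?_
    rw [← val_glue_right s t hi, h, hs, val_glue_right s' t' (by omega)]

theorem snoc_injective {s s' : SizedPerm} (h : snoc s = snoc s') : s = s' := by
  have hs : s.size + 1 = s'.size + 1 := by rw [← size_snoc, ← size_snoc, h]
  exact ext_val (by omega) fun i hi => by rw [← val_snoc, h, val_snoc]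

theorem arch_injective {α β α' β' : SizedPerm} (h : arch α β = arch α' β') :
    α = α' ∧ β = β' := by
  obtain ⟨rfl, h2⟩ := glue_injective h
  have hs : β.size + (α.size + 1) = β'.size + (α.size + 1) := by
    have := congrArg size h2; simpa using this
  refine ⟨rfl, ext_val (by omega) fun i hi => ?_⟩
  have := val_skew_left (snoc α.inv) hi
  rw [h2, val_skew_left _ (by omega)] at this
  omega

/-- Being an involution. -/
def IsInvol (t : SizedPerm) : Prop := ∀ i, t.val (t.val i) = i

theorem isInvol_iff {n : ℕ} (π : Equiv.Perm (Fin n)) : IsInvol ⟨n, π⟩ ↔ π⁻¹ = π := by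
  constructor
  · intro h
    ext i
    have h1 := h (π⁻¹ i : Fin n)
    rw [val_fin ⟨n, π⟩, val_fin ⟨n, π⟩] at h1
    simpa using h1.symm
  · intro h i
    have := val_inv_val ⟨n, π⟩ i
    simpa only [inv, h] using this

theorem isInvol_empty : IsInvol empty := fun i => by
  rw [val_of_le (t := empty) (by simp), val_of_le (by simp)]

theorem isInvol_snoc {s : SizedPerm} : IsInvol (snoc s) ↔ IsInvol s := by simp [IsInvol]

theorem isInvol_arch {α β : SizedPerm} : IsInvol (arch α β) ↔ IsInvol β := by
  constructor
  · intro h i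
    rcases Nat.lt_or_ge i β.size with hi | hi
    · have h1 := h (α.size + 1 + i)
      rw [val_arch_mid α hi, Nat.add_comm, val_arch_mid α (val_lt β hi)] at h1
      omega
    · rw [val_of_le hi, val_of_le hi]
  · intro h i
    have hl : ∀ {j}, j ≤ α.size → α.val j ≤ α.size := fun {j} hj => by
      have := val_lt (snoc α) (i := j) (by simp; omega)
      rw [val_snoc] at this; simp at this; omega
    have hl' : ∀ {j}, j ≤ α.size → α.inv.val j ≤ α.size := fun {j} hj => by
      have := val_lt (snoc α.inv) (i := j) (by simp; omega)
      rw [val_snoc] at this; simp at this; omega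
    rcases Nat.lt_or_ge i (arch α β).size with hi | hi
    · rw [size_arch] at hi
      rcases Nat.lt_or_ge i (α.size + 1) with h1 | h1
      · rw [val_arch_left β (i := i) (by omega), show α.val i + (β.size + (α.size + 1))
          = α.size + 1 + (β.size + α.val i) by omega, val_arch_right _ _ (hl (by omega)),
          val_inv_val]
      obtain ⟨j, rfl⟩ := Nat.exists_eq_add_of_le h1
      rcases Nat.lt_or_ge j β.size with h2 | h2
      · rw [val_arch_mid α h2, Nat.add_comm, val_arch_mid α (val_lt β h2), h]; omega
      obtain ⟨j, rfl⟩ := Nat.exists_eq_add_of_le h2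
      rw [val_arch_right α β (by omega), val_arch_left β (hl' (by omega)), val_val_inv]
      omega
    · rw [val_of_le hi, val_of_le hi]

/-! ### Patterns in sums of permutations -/

/-- `u 0, …, u (m-1)` are the positions of an increasing subsequence of `t`. -/
def IncSeq (t : SizedPerm) (m : ℕ) (u : ℕ → ℕ) : Prop :=
  (∀ i < m, u i < t.size) ∧ ∀ i j, i < j → j < m → u i < u j ∧ t.val (u i) < t.val (u j)

/-- `t` has an increasing subsequence of length `m`. -/
def HasInc (t : SizedPerm) (m : ℕ) : Prop := ∃ u, IncSeq t m u

/-- `t` contains the pattern `(12…p) ⊖ (12…q)`. -/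
def HasRot (t : SizedPerm) (p q : ℕ) : Prop :=
  ∃ u w, IncSeq t p u ∧ IncSeq t q w ∧
    ∀ i < p, ∀ j < q, u i < w j ∧ t.val (w j) < t.val (u i)

/-- `t` contains the pattern `132`. -/
def Has132 (t : SizedPerm) : Prop :=
  ∃ i j k, i < j ∧ j < k ∧ k < t.size ∧ t.val i < t.val k ∧ t.val k < t.val j

theorem contains_of_imp {n k : ℕ} {π : Equiv.Perm (Fin n)} {τ : Equiv.Perm (Fin k)}
    (f : Fin k → Fin n) (hf : StrictMono f) (h : ∀ i j, τ i < τ j → π (f i) < π (f j)) :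
    Contains π τ := by
  refine ⟨f, hf, fun i j => ⟨fun hij => ?_, h i j⟩⟩
  rcases lt_trichotomy (τ i) (τ j) with h1 | h1 | h1
  · exact h1
  · rw [τ.injective h1] at hij; exact absurd hij (lt_irrefl _)
  · exact absurd (hij.trans (h _ _ h1)) (lt_irrefl _)

theorem contains_increasing {n : ℕ} (π : Equiv.Perm (Fin n)) (m : ℕ) :
    Contains π (increasing m) ↔ HasInc ⟨n, π⟩ m := by
  constructor
  · rintro ⟨f, hf, h⟩
    refine ⟨fun i => if hi : i < m then f ⟨i, hi⟩ else 0, fun i hi => ?_, fun i j hij hj => ?_⟩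
    · simp [hi]
    · have hi := hij.trans hj
      simp only [hi, hj, dif_pos]
      rw [val_fin ⟨n, π⟩, val_fin ⟨n, π⟩]
      have hl : (⟨i, hi⟩ : Fin m) < ⟨j, hj⟩ := hij
      exact ⟨hf hl, (h ⟨i, hi⟩ ⟨j, hj⟩).2 hl⟩
  · rintro ⟨u, hu, h⟩
    refine contains_of_imp (fun i => ⟨u i, hu i i.2⟩) (fun i j hij => (h i j hij j.2).1)
      fun i j hij => ?_
    have := (h i j hij j.2).2
    rw [Fin.lt_def]
    simpa [val, hu i i.2, hu j j.2] using this

theorem contains_rotated {n : ℕ} (π : Equiv.Perm (Fin n)) {k d : ℕ} (hdk : d ≤ k) :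
    Contains π (rotated k d) ↔ HasRot ⟨n, π⟩ (k - d) d := by
  have hr1 : ∀ i : Fin k, (i : ℕ) < k - d → (rotated k d i : ℕ) = i + d := fun i hi => by
    rw [rotated_apply, Nat.mod_eq_of_lt (by omega)]
  have hr2 : ∀ i : Fin k, k - d ≤ (i : ℕ) → (rotated k d i : ℕ) = i + d - k := fun i hi => by
    rw [rotated_apply, Nat.mod_eq_sub_mod (by omega), Nat.mod_eq_of_lt (by omega)]
  constructor
  · rintro ⟨f, hf, h⟩
    have key : ∀ i j : Fin k, (rotated k d i : ℕ) < rotated k d j →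
        val ⟨n, π⟩ (f i) < val ⟨n, π⟩ (f j) := fun i j hij => by
      rw [val_fin ⟨n, π⟩, val_fin ⟨n, π⟩]; exact (h i j).2 hij
    have hf' : ∀ i j : Fin k, (i : ℕ) < j → (f i : ℕ) < f j := fun i j hij => hf hij
    refine ⟨fun i => if hi : i < k then f ⟨i, hi⟩ else 0,
      fun i => if hi : k - d + i < k then f ⟨k - d + i, hi⟩ else 0,
      ⟨fun i hi => ?_, fun i j hij hj => ?_⟩, ⟨fun i hi => ?_, fun i j hij hj => ?_⟩,
      fun i hi j hj => ?_⟩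
    · simp [show i < k by omega]
    · simp only [show i < k by omega, show j < k by omega, dif_pos]
      refine ⟨hf' _ _ hij, key _ _ ?_⟩
      rw [hr1 _ (by dsimp only; omega), hr1 _ hj]; dsimp only; omega
    · simp [show k - d + i < k by omega]
    · simp only [show k - d + i < k by omega, show k - d + j < k by omega, dif_pos]
      refine ⟨hf' _ _ (by dsimp only; omega), key _ _ ?_⟩
      rw [hr2 _ (by dsimp only; omega), hr2 _ (by dsimp only; omega)]; dsimp only; omega
    · simp only [show i < k by omega, show k - d + j < k by omega, dif_pos]
      refine ⟨hf' _ _ (by dsimp only; omega), key _ _ ?_⟩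
      rw [hr2 _ (by dsimp only; omega), hr1 _ (by dsimp only; omega)]; dsimp only; omega
  · rintro ⟨u, w, ⟨hu, hu'⟩, ⟨hw, hw'⟩, huw⟩
    set F : ℕ → ℕ := fun i => if i < k - d then u i else w (i - (k - d)) with hF
    have hFn : ∀ i : Fin k, F i < n := fun i => by
      simp only [hF]
      split_ifs with h
      · exact hu _ h
      · exact hw _ (by omega)
    refine contains_of_imp (fun i => ⟨F i, hFn i⟩) (fun i j hij => ?_) fun i j hij => ?_
    · rw [Fin.lt_def] at hij ⊢
      simp only [hF]
      split_ifs with h1 h2 h2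
      · exact (hu' _ _ hij h2).1
      · exact (huw _ h1 _ (by omega)).1
      · omega
      · exact (hw' _ _ (by omega) (by omega)).1
    · have : val ⟨n, π⟩ (F i) < val ⟨n, π⟩ (F j) := by
        rw [Fin.lt_def] at hij
        simp only [hF]
        split_ifs with h1 h2 h2
        · rw [hr1 _ h1, hr1 _ h2] at hij
          exact (hu' _ _ (by omega) h2).2
        · rw [hr1 _ h1, hr2 _ (by omega)] at hij; omega
        · exact (huw _ h2 _ (by omega)).2
        · rw [hr2 _ (by omega), hr2 _ (by omega)] at hij
          exact (hw' _ _ (by omega) (by omega)).2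
      rw [Fin.lt_def]
      simpa [val, hFn] using this

theorem contains_pattern132 {n : ℕ} (π : Equiv.Perm (Fin n)) :
    Contains π pattern132 ↔ Has132 ⟨n, π⟩ := by
  constructor
  · rintro ⟨f, hf, h⟩
    refine ⟨f 0, f 1, f 2, hf (by decide), hf (by decide), (f 2).2, ?_, ?_⟩
    · rw [val_fin ⟨n, π⟩, val_fin ⟨n, π⟩]; exact (h 0 2).2 (by decide)
    · rw [val_fin ⟨n, π⟩, val_fin ⟨n, π⟩]; exact (h 2 1).2 (by decide)
  · rintro ⟨i, j, k, hij, hjk, hk, h1, h2⟩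
    have hk : k < n := hk
    have hj : j < n := by omega
    have hi : i < n := by omega
    simp only [val, hi, hj, hk, dif_pos] at h1 h2
    refine contains_of_imp ![⟨i, hi⟩, ⟨j, hj⟩, ⟨k, hk⟩] ?_ ?_
    · intro a b hab
      fin_cases a <;> fin_cases b <;> simp [Fin.lt_def] at hab ⊢ <;> omega
    · intro a b hab
      rw [Fin.lt_def]
      fin_cases a <;> fin_cases b <;>
        first
        | exact absurd hab (by decide)
        | exact h1
        | exact h2
        | exact h1.trans h2

theorem HasInc.mono {t : SizedPerm} {m m' : ℕ} (h : HasInc t m') (hm : m ≤ m') : HasInc t m := by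
  obtain ⟨u, hu, hu'⟩ := h
  exact ⟨u, fun i hi => hu i (by omega), fun i j hij hj => hu' i j hij (by omega)⟩

theorem hasInc_zero (t : SizedPerm) : HasInc t 0 :=
  ⟨id, fun i hi => by omega, fun i j _ hj => by omega⟩

theorem not_hasInc_empty (m : ℕ) : ¬ HasInc empty (m + 1) := by
  rintro ⟨u, hu, -⟩
  have := hu 0 (by omega)
  simp at this

theorem HasRot.hasInc {t : SizedPerm} {p q : ℕ} (h : HasRot t p q) : HasInc t p := by
  obtain ⟨u, -, hu, -⟩ := h
  exact ⟨u, hu⟩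

theorem HasInc.inv {t : SizedPerm} {m : ℕ} (h : HasInc t m) : HasInc t.inv m := by
  obtain ⟨u, hu, hu'⟩ := h
  refine ⟨fun i => t.val (u i), fun i hi => val_lt t (hu i hi), fun i j hij hj => ?_⟩
  rw [val_inv_val, val_inv_val]
  exact (hu' i j hij hj).symm

theorem hasInc_inv {t : SizedPerm} {m : ℕ} : HasInc t.inv m ↔ HasInc t m :=
  ⟨fun h => by simpa only [inv_inv] using h.inv, HasInc.inv⟩

theorem IncSeq.skew_left {s : SizedPerm} {m : ℕ} {u : ℕ → ℕ} (h : IncSeq s m u) (t : SizedPerm) :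
    IncSeq (skew s t) m u :=
  ⟨fun i hi => by have := h.1 i hi; simp; omega, fun i j hij hj => by
    rw [val_skew_left t (h.1 i (hij.trans hj)), val_skew_left t (h.1 j hj)]
    have := h.2 i j hij hj
    omega⟩

theorem IncSeq.skew_right {t : SizedPerm} {m : ℕ} {u : ℕ → ℕ} (h : IncSeq t m u) (s : SizedPerm) :
    IncSeq (skew s t) m (fun i => s.size + u i) :=
  ⟨fun i hi => by have := h.1 i hi; simp; omega, fun i j hij hj => by
    rw [val_skew_right s t _ (h.1 i (hij.trans hj)), val_skew_right s t _ (h.1 j hj)]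
    have := h.2 i j hij hj
    dsimp only
    omega⟩

/-- An increasing subsequence of a skew sum stays within one summand. -/
theorem IncSeq.of_skew {s t : SizedPerm} {m : ℕ} {u : ℕ → ℕ} (h : IncSeq (skew s t) m u) :
    IncSeq s m u ∨ (∀ i < m, s.size ≤ u i) ∧ IncSeq t m (fun i => u i - s.size) := by
  obtain ⟨h1, h2⟩ := h
  by_cases hall : ∀ i < m, u i < s.size
  · refine Or.inl ⟨hall, fun i j hij hj => ?_⟩
    have := h2 i j hij hj
    rw [val_skew_left t (hall i (by omega)), val_skew_left t (hall j hj)] at this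
    omega
  · push Not at hall
    obtain ⟨i₀, hi₀, hu₀⟩ := hall
    have hb : ∀ i < m, u i < s.size + t.size := h1
    have hge : ∀ i < m, s.size ≤ u i := by
      intro i hi
      by_contra hlt
      push Not at hlt
      have v1 := val_skew_left t hlt
      have v2 := val_skew_of_le s t hu₀ (hb _ hi₀)
      have v3 := val_lt t (i := u i₀ - s.size) (by have := hb _ hi₀; omega)
      rcases lt_trichotomy i i₀ with hc | rfl | hc
      · have := h2 i i₀ hc hi₀; omega
      · omega
      · have := h2 i₀ i hc hi; omega
    refine Or.inr ⟨hge, fun i hi => ?_, fun i j hij hj => ?_⟩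
    · have := hb i hi; have := hge i hi; dsimp only; omega
    · have := h2 i j hij hj
      rw [val_skew_of_le s t (hge i (by omega)) (hb i (by omega)),
        val_skew_of_le s t (hge j hj) (hb j hj)] at this
      have := hge i (by omega)
      dsimp only
      omega

theorem hasInc_skew {s t : SizedPerm} {m : ℕ} :
    HasInc (skew s t) m ↔ HasInc s m ∨ HasInc t m := by
  constructor
  · rintro ⟨u, hu⟩
    rcases hu.of_skew with h | ⟨-, h⟩
    · exact Or.inl ⟨_, h⟩
    · exact Or.inr ⟨_, h⟩
  · rintro (⟨u, h⟩ | ⟨u, h⟩)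
    · exact ⟨_, h.skew_left t⟩
    · exact ⟨_, h.skew_right s⟩

theorem hasRot_skew {s t : SizedPerm} {p q : ℕ} (hp : 1 ≤ p) (hq : 1 ≤ q) :
    HasRot (skew s t) p q ↔ HasRot s p q ∨ HasRot t p q ∨ HasInc s p ∧ HasInc t q := by
  constructor
  · rintro ⟨u, w, hu, hw, huw⟩
    rcases hu.of_skew with h | ⟨hge, h⟩ <;> rcases hw.of_skew with h' | ⟨hge', h'⟩
    · refine Or.inl ⟨u, w, h, h', fun i hi j hj => ?_⟩
      have := huw i hi j hj
      rw [val_skew_left t (h.1 i hi), val_skew_left t (h'.1 j hj)] at this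
      omega
    · exact Or.inr (Or.inr ⟨⟨_, h⟩, ⟨_, h'⟩⟩)
    · have := huw 0 hp 0 hq
      have := hge 0 hp
      have := h'.1 0 hq
      omega
    · refine Or.inr (Or.inl ⟨_, _, h, h', fun i hi j hj => ?_⟩)
      have := huw i hi j hj
      rw [val_skew_of_le s t (hge i hi) (hu.1 i hi),
        val_skew_of_le s t (hge' j hj) (hw.1 j hj)] at this
      have := hge i hi
      omega
  · rintro (⟨u, w, hu, hw, h⟩ | ⟨u, w, hu, hw, h⟩ | ⟨⟨u, hu⟩, ⟨w, hw⟩⟩)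
    · refine ⟨_, _, hu.skew_left t, hw.skew_left t, fun i hi j hj => ?_⟩
      rw [val_skew_left t (hu.1 i hi), val_skew_left t (hw.1 j hj)]
      have := h i hi j hj
      omega
    · refine ⟨_, _, hu.skew_right s, hw.skew_right s, fun i hi j hj => ?_⟩
      rw [val_skew_right s t _ (hu.1 i hi), val_skew_right s t _ (hw.1 j hj)]
      have := h i hi j hj
      omega
    · refine ⟨_, _, hu.skew_left t, hw.skew_right s, fun i hi j hj => ?_⟩
      rw [val_skew_left t (hu.1 i hi), val_skew_right s t _ (hw.1 j hj)]
      have := hu.1 i hi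
      have := val_lt t (hw.1 j hj)
      omega

theorem hasInc_snoc {s : SizedPerm} {m : ℕ} : HasInc (snoc s) (m + 1) ↔ HasInc s m := by
  constructor
  · rintro ⟨u, hu, hu'⟩
    refine ⟨u, fun i hi => ?_, fun i j hij hj => ?_⟩
    · have := hu m (by omega)
      have := hu' i m hi (by omega)
      simp only [size_snoc] at *
      omega
    · simpa using hu' i j hij (by omega)
  · rintro ⟨u, hu, hu'⟩
    refine ⟨fun i => if i < m then u i else s.size, fun i hi => ?_, fun i j hij hj => ?_⟩
    · dsimp only
      split_ifs with h
      · have := hu i h; simp; omega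
      · simp
    · have him : i < m := by omega
      simp only [him, if_true, val_snoc]
      split_ifs with h
      · exact hu' i j hij h
      · rw [val_of_le (le_refl s.size)]
        exact ⟨hu i him, val_lt s (hu i him)⟩

theorem hasRot_snoc {s : SizedPerm} {p q : ℕ} (hp : 1 ≤ p) (hq : 1 ≤ q) :
    HasRot (snoc s) p q ↔ HasRot s p q := by
  constructor
  · rintro ⟨u, w, ⟨hu, hu'⟩, ⟨hw, hw'⟩, h⟩
    have hbu : ∀ i < p, u i < s.size := fun i hi => by
      have := (h i hi 0 hq).1
      have := hw 0 hq
      simp only [size_snoc] at this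
      omega
    -- the new letter is too large to play a role in the lower block
    have hbw : ∀ j < q, w j < s.size := fun j hj => by
      have h1 := hw j hj
      simp only [size_snoc] at h1
      by_contra h2
      have h3 := (h 0 hp j hj).2
      rw [val_snoc, val_snoc, val_of_le (by omega)] at h3
      have := val_lt s (hbu 0 hp)
      omega
    refine ⟨u, w, ⟨hbu, fun i j hij hj => ?_⟩, ⟨hbw, fun i j hij hj => ?_⟩, fun i hi j hj => ?_⟩
    · simpa using hu' i j hij hj
    · simpa using hw' i j hij hj
    · simpa using h i hi j hj
  · rintro ⟨u, w, ⟨hu, hu'⟩, ⟨hw, hw'⟩, h⟩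
    refine ⟨u, w, ⟨fun i hi => (hu i hi).trans (by simp), fun i j hij hj => ?_⟩,
      ⟨fun i hi => (hw i hi).trans (by simp), fun i j hij hj => ?_⟩, fun i hi j hj => ?_⟩
    · simpa using hu' i j hij hj
    · simpa using hw' i j hij hj
    · simpa using h i hi j hj

theorem hasInc_glue {s t : SizedPerm} {m : ℕ} :
    HasInc (glue s t) (m + 1) ↔ HasInc s m ∨ HasInc t (m + 1) := by
  rw [glue, hasInc_skew, hasInc_snoc]

theorem hasInc_arch {α β : SizedPerm} {m : ℕ} :
    HasInc (arch α β) (m + 1) ↔ HasInc α m ∨ HasInc β (m + 1) := by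
  rw [arch, hasInc_skew, hasInc_skew, hasInc_snoc, hasInc_snoc, hasInc_inv]
  tauto

/-- Since the two outer summands of `arch α β` have increasing subsequences of the same length,
as soon as one of them has one of length `m + 1` the pattern occurs. -/
theorem hasRot_arch {α β : SizedPerm} {m e : ℕ} (he : e ≤ m) :
    HasRot (arch α β) (m + 1) (e + 1) ↔
      HasInc α m ∨ HasRot β (m + 1) (e + 1) ∨ HasInc β (m + 1) ∧ HasInc α e := by
  rw [arch, hasRot_skew (by omega) (by omega), hasRot_skew (by omega) (by omega), hasInc_skew,
    hasInc_snoc, hasInc_snoc, hasInc_inv]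
  have h1 : HasRot (snoc α) (m + 1) (e + 1) → HasInc α m := fun h => hasInc_snoc.1 h.hasInc
  have h2 : HasRot (snoc α.inv) (m + 1) (e + 1) → HasInc α m :=
    fun h => hasInc_inv.1 (hasInc_snoc.1 h.hasInc)
  have h3 : HasInc α m → HasInc α e := fun h => h.mono he
  tauto

theorem Has132.inv {t : SizedPerm} (h : Has132 t) : Has132 t.inv := by
  obtain ⟨i, j, k, hij, hjk, hk, h1, h2⟩ := h
  refine ⟨t.val i, t.val k, t.val j, h1, h2, val_lt t (by omega), ?_⟩
  simp only [val_inv_val]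
  exact ⟨hij, hjk⟩

theorem has132_inv {t : SizedPerm} : Has132 t.inv ↔ Has132 t :=
  ⟨fun h => by simpa only [inv_inv] using h.inv, Has132.inv⟩

theorem not_has132_empty : ¬ Has132 empty := by
  rintro ⟨i, j, k, -, -, hk, -⟩
  simp at hk

theorem has132_snoc {s : SizedPerm} : Has132 (snoc s) ↔ Has132 s := by
  constructor
  · rintro ⟨i, j, k, hij, hjk, hk, h1, h2⟩
    simp only [val_snoc, size_snoc] at *
    refine ⟨i, j, k, hij, hjk, ?_, h1, h2⟩
    by_contra h
    rw [val_of_le (i := k) (by omega)] at h2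
    have := val_lt s (i := j) (by omega)
    omega
  · rintro ⟨i, j, k, hij, hjk, hk, h1, h2⟩
    exact ⟨i, j, k, hij, hjk, by simp; omega, by simpa using h1, by simpa using h2⟩

theorem has132_skew {s t : SizedPerm} : Has132 (skew s t) ↔ Has132 s ∨ Has132 t := by
  constructor
  · rintro ⟨i, j, k, hij, hjk, hk, h1, h2⟩
    rw [size_skew] at hk
    rcases Nat.lt_or_ge i s.size with hi | hi
    · rw [val_skew_left t hi] at h1
      -- the last two letters of the pattern exceed the first one
      have hk' : k < s.size := by
        by_contra h
        rw [val_skew_of_le s t (by omega) hk] at h1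
        have := val_lt t (i := k - s.size) (by omega)
        omega
      rw [val_skew_left t hk'] at h1 h2
      rw [val_skew_left t (by omega)] at h2
      exact Or.inl ⟨i, j, k, hij, hjk, hk', by omega, by omega⟩
    · rw [val_skew_of_le s t (i := k) (by omega) (by omega)] at h1 h2
      rw [val_skew_of_le s t (by omega) (by omega)] at h1 h2
      exact Or.inr ⟨i - s.size, j - s.size, k - s.size, by omega, by omega, by omega, h1, h2⟩
  · rintro (⟨i, j, k, hij, hjk, hk, h1, h2⟩ | ⟨i, j, k, hij, hjk, hk, h1, h2⟩)
    · refine ⟨i, j, k, hij, hjk, by simp; omega, ?_, ?_⟩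
      · rw [val_skew_left t (by omega), val_skew_left t (by omega)]; omega
      · rw [val_skew_left t (by omega), val_skew_left t (by omega)]; omega
    · refine ⟨s.size + i, s.size + j, s.size + k, by omega, by omega, by simp; omega, ?_, ?_⟩
      · rwa [val_skew_right s t _ (by omega), val_skew_right s t _ hk]
      · rwa [val_skew_right s t _ hk, val_skew_right s t _ (by omega)]

theorem has132_glue {s t : SizedPerm} : Has132 (glue s t) ↔ Has132 s ∨ Has132 t := by
  rw [glue, has132_skew, has132_snoc]

theorem has132_arch {α β : SizedPerm} : Has132 (arch α β) ↔ Has132 α ∨ Has132 β := by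
  rw [arch, has132_skew, has132_skew, has132_snoc, has132_snoc, has132_inv]
  tauto

/-! ### Decomposition of the permutations avoiding `132` -/

/-- In a permutation avoiding `132`, the letters in front of the largest one exceed those behind
it. -/
theorem val_lt_iff_of_not_has132 {t : SizedPerm} (h : ¬ Has132 t) {n p : ℕ} (hn : t.size = n + 1)
    (hp : t.val p = n) {i : ℕ} (hi : i < t.size) : t.val i < n - p ↔ p < i := by
  have hpn : p ≤ n := by
    by_contra hlt
    rw [val_of_le (by omega)] at hp
    omega
  have hsep : ∀ i j, i < p → p < j → j < t.size → t.val j < t.val i := by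
    intro i j hi hj hjt
    by_contra hlt
    have h1 : t.val i ≠ t.val j := fun e => by have := val_inj t e; omega
    have h2 : t.val j ≠ t.val p := fun e => by have := val_inj t e; omega
    have h3 := val_lt t hjt
    exact h ⟨i, p, j, hi, hj, hjt, by omega, by omega⟩
  -- the positions behind `p` and the letters below `n - p` are equally many
  have hsub : (Finset.Ioc p n).image t.val ⊆ Finset.range (n - p) := by
    intro y hy
    obtain ⟨j, hj, rfl⟩ := Finset.mem_image.1 hy
    rw [Finset.mem_Ioc] at hj
    rw [Finset.mem_range]
    by_contra hge
    have hs : Finset.range (t.val j + 1) ⊆ (Finset.Ioc p n).image t.val := by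
      intro z hz
      rw [Finset.mem_range] at hz
      have hjt := val_lt t (i := j) (by omega)
      have h2 : t.val j ≠ t.val p := fun e => by have := val_inj t e; omega
      refine Finset.mem_image.2 ⟨t.inv.val z, ?_, val_val_inv t z⟩
      have h3 := val_lt t.inv (i := z) (by simp; omega)
      rw [size_inv] at h3
      rw [Finset.mem_Ioc]
      refine ⟨?_, by omega⟩
      by_contra hle
      rcases Nat.lt_or_ge (t.inv.val z) p with h4 | h4
      · have := hsep _ j h4 hj.1 (by omega)
        rw [val_val_inv] at this; omega
      · have h5 : t.inv.val z = p := by omega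
        have h6 : z = n := by rw [← val_val_inv t z, h5, hp]
        omega
    have := Finset.card_le_card hs
    rw [Finset.card_range, Finset.card_image_of_injective _ fun _ _ => val_inj t,
      Nat.card_Ioc] at this
    omega
  have heq := Finset.eq_of_subset_of_card_le hsub (by
    rw [Finset.card_range, Finset.card_image_of_injective _ fun _ _ => val_inj t, Nat.card_Ioc])
  rw [← Finset.mem_range, ← heq, Finset.mem_image]
  constructor
  · rintro ⟨j, hj, hij⟩
    rw [← val_inj t hij]; exact (Finset.mem_Ioc.1 hj).1
  · intro hlt
    exact ⟨i, Finset.mem_Ioc.2 ⟨hlt, by omega⟩, rfl⟩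

theorem exists_glue {t : SizedPerm} (h : ¬ Has132 t) (h0 : t.size ≠ 0) :
    ∃ a b, t = glue a b := by
  obtain ⟨n, hn⟩ := Nat.exists_eq_succ_of_ne_zero h0
  obtain ⟨p, hp⟩ : ∃ p, t.val p = n := ⟨_, val_val_inv t n⟩
  have key := fun {i} => val_lt_iff_of_not_has132 h hn hp (i := i)
  have hpn : p ≤ n := by
    by_contra hlt
    rw [val_of_le (by omega)] at hp
    omega
  have hlt : ∀ i < p, n - p ≤ t.val i ∧ t.val i < n := fun i hi => by
    have := val_lt t (i := i) (by omega)
    have h2 : t.val i ≠ t.val p := fun e => by have := val_inj t e; omega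
    have := key (i := i) (by omega)
    omega
  obtain ⟨a, has, ha⟩ : ∃ a : SizedPerm, a.size = p ∧ ∀ i < p, a.val i = t.val i - (n - p) :=
    ⟨ofFun p (fun i => t.val i - (n - p)) (fun i hi => by have := hlt i hi; omega)
      (fun i hi j hj e => by
        have := hlt i hi; have := hlt j hj
        exact val_inj t (by omega)), rfl, fun i hi => val_ofFun hi⟩
  obtain ⟨b, hbs, hb⟩ : ∃ b : SizedPerm, b.size = n - p ∧
      ∀ i < n - p, b.val i = t.val (p + 1 + i) :=
    ⟨ofFun (n - p) (fun i => t.val (p + 1 + i)) (fun i hi => (key (by omega)).2 (by omega))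
      (fun i hi j hj e => by have := val_inj t e; omega), rfl, fun i hi => val_ofFun hi⟩
  refine ⟨a, b, ext_val (by simp only [size_glue]; omega) fun i hi => ?_⟩
  rcases Nat.lt_or_ge i (a.size + 1) with h1 | h1
  · rw [val_glue_left _ (by omega)]
    rcases Nat.lt_or_ge i p with h2 | h2
    · rw [ha i h2]; have := hlt i h2; omega
    · obtain rfl : i = p := by omega
      rw [val_of_le (t := a) (by omega)]; omega
  · obtain ⟨j, rfl⟩ := Nat.exists_eq_add_of_le h1
    rw [val_glue_right a b (by omega), hb j (by omega), has]

/-- An involution avoiding `132` either fixes the largest letter or exchanges it with some `p`; in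
the latter case the letters behind `p` are the smallest ones, and symmetry determines the last
`p + 1` of them. -/
theorem exists_snoc_or_arch {t : SizedPerm} (h : ¬ Has132 t) (ht : IsInvol t) (h0 : t.size ≠ 0) :
    (∃ s, t = snoc s) ∨ ∃ α β, t = arch α β := by
  obtain ⟨n, hn⟩ := Nat.exists_eq_succ_of_ne_zero h0
  obtain ⟨p, hp⟩ : ∃ p, t.val p = n := ⟨_, val_val_inv t n⟩
  have hpn : p ≤ n := by
    by_contra hlt
    rw [val_of_le (by omega)] at hp
    omega
  have hnp : t.val n = p := by rw [← hp, ht]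
  have hne : ∀ {i}, i ≠ p → t.val i ≠ n := fun hi e => hi (val_inj t (e.trans hp.symm))
  have hne' : ∀ {i}, i ≠ n → t.val i ≠ p := fun hi e => hi (val_inj t (e.trans hnp.symm))
  rcases hpn.eq_or_lt with rfl | hlt
  · left
    refine ⟨ofFun p t.val (fun i hi => ?_) (fun i _ j _ e => val_inj t e),
      ext_val (by simp [hn]) fun i hi => ?_⟩
    · have := val_lt t (i := i) (by omega)
      have := hne (i := i) (by omega)
      omega
    · rw [val_snoc]
      rcases Nat.lt_or_ge i p with h1 | h1
      · rw [val_ofFun h1]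
      · obtain rfl : i = p := by omega
        rw [val_of_le (t := ofFun _ _ _ _) (by simp), hp]
  · right
    have key := fun {i} => val_lt_iff_of_not_has132 h hn hp (i := i)
    have h2p : p < n - p := by have := (key (i := n) (by omega)).2 hlt; omega
    have hl : ∀ i < p, n - p ≤ t.val i ∧ t.val i < n := fun i hi => by
      have := val_lt t (i := i) (by omega)
      have := hne (i := i) (by omega)
      have := key (i := i) (by omega)
      omega
    have hm : ∀ i, p < i → i < n - p → p < t.val i ∧ t.val i < n - p := fun i hi hi' => by
      have h1 := (key (i := i) (by omega)).2 hi
      have h2 := hne' (i := i) (by omega)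
      refine ⟨?_, h1⟩
      by_contra h3
      have := hl (t.val i) (by omega)
      rw [ht] at this
      omega
    have hr : ∀ i, n - p ≤ i → i < n → t.val i < p := fun i hi hi' => by
      have h1 := (key (i := i) (by omega)).2 (by omega)
      have h2 := hne' (i := i) (by omega)
      by_contra h3
      have := key (i := t.val i) (by omega)
      rw [ht] at this
      omega
    obtain ⟨α, hαs, hα⟩ : ∃ α : SizedPerm, α.size = p ∧ ∀ i < p, α.val i = t.val i - (n - p) :=
      ⟨ofFun p (fun i => t.val i - (n - p)) (fun i hi => by have := hl i hi; omega)
        (fun i hi j hj e => by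
          have := hl i hi; have := hl j hj
          exact val_inj t (by omega)), rfl, fun i hi => val_ofFun hi⟩
    obtain ⟨β, hβs, hβ⟩ : ∃ β : SizedPerm, β.size = n - p - (p + 1) ∧
        ∀ i < n - p - (p + 1), β.val i = t.val (p + 1 + i) - (p + 1) :=
      ⟨ofFun (n - p - (p + 1)) (fun i => t.val (p + 1 + i) - (p + 1))
        (fun i hi => by have := hm (p + 1 + i) (by omega) (by omega); omega)
        (fun i hi j hj e => by
          have := hm (p + 1 + i) (by omega) (by omega)
          have := hm (p + 1 + j) (by omega) (by omega)
          have := val_inj t (i := p + 1 + i) (j := p + 1 + j) (by omega)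
          omega), rfl, fun i hi => val_ofFun hi⟩
    refine ⟨α, β, ext_val (by simp only [size_arch]; omega) fun i hi => ?_⟩
    rcases Nat.lt_or_ge i (α.size + 1) with h1 | h1
    · rw [val_arch_left β (by omega)]
      rcases Nat.lt_or_ge i p with h2 | h2
      · rw [hα i h2]; have := hl i h2; omega
      · obtain rfl : i = p := by omega
        rw [val_of_le (t := α) (by omega)]; omega
    obtain ⟨j, rfl⟩ := Nat.exists_eq_add_of_le h1
    rcases Nat.lt_or_ge j β.size with h2 | h2
    · rw [val_arch_mid α h2, hβ j (by omega), hαs]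
      have := hm (p + 1 + j) (by omega) (by omega)
      omega
    obtain ⟨l, rfl⟩ := Nat.exists_eq_add_of_le h2
    rw [val_arch_right α β (by omega)]
    rcases Nat.lt_or_ge l p with h3 | h3
    · have h4 := hr (α.size + 1 + (β.size + l)) (by omega) (by omega)
      have h5 := hα _ h4
      rw [ht] at h5
      rw [show l = α.val (t.val (α.size + 1 + (β.size + l))) by omega, val_inv_val,
        ← show l = α.val (t.val (α.size + 1 + (β.size + l))) by omega]
    · rw [val_of_le (t := α.inv) (by simp; omega),
        show α.size + 1 + (β.size + l) = n by omega, hnp]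
      omega

/-! ### Inversions -/

/-- The number of inversions. -/
def invs (t : SizedPerm) : ℕ := inversions t.2

theorem invs_eq_sum (t : SizedPerm) :
    t.invs = ∑ i ∈ Finset.range t.size, ∑ j ∈ Finset.range t.size,
      if i < j ∧ t.val j < t.val i then 1 else 0 := by
  rw [invs, inversions, Finset.card_filter, Fintype.sum_prod_type, Finset.sum_range]
  refine Finset.sum_congr rfl fun i _ => ?_
  rw [Finset.sum_range]
  refine Finset.sum_congr rfl fun j _ => ?_
  rw [val_fin, val_fin]
  rfl

theorem invs_empty : invs empty = 0 := by simp [invs_eq_sum]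

theorem invs_snoc (s : SizedPerm) : invs (snoc s) = invs s := by
  simp only [invs_eq_sum, size_snoc, val_snoc, Finset.sum_range_succ]
  rw [Finset.sum_eq_zero (s := Finset.range s.size) (f := fun j => if s.size < j ∧ _ then 1 else 0)]
  · simp only [lt_irrefl, false_and, if_false, add_zero]
    refine Finset.sum_congr rfl fun i hi => ?_
    rw [if_neg, add_zero]
    rw [val_of_le (le_refl s.size)]
    have := val_lt s (Finset.mem_range.1 hi)
    omega
  · intro j hj
    rw [Finset.mem_range] at hj
    rw [if_neg]; omega

theorem invs_skew (s t : SizedPerm) :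
    invs (skew s t) = invs s + invs t + s.size * t.size := by
  simp only [invs_eq_sum, size_skew, Finset.sum_range_add, Finset.sum_add_distrib]
  have h1 : ∀ i ∈ Finset.range s.size, ∀ j ∈ Finset.range s.size,
      (if i < j ∧ (skew s t).val j < (skew s t).val i then 1 else 0)
        = if i < j ∧ s.val j < s.val i then 1 else 0 := by
    intro i hi j hj
    rw [val_skew_left t (Finset.mem_range.1 hi), val_skew_left t (Finset.mem_range.1 hj)]
    simp
  have h2 : ∀ i ∈ Finset.range s.size, ∀ j ∈ Finset.range t.size,
      (if i < s.size + j ∧ (skew s t).val (s.size + j) < (skew s t).val i then 1 else 0) = 1 := by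
    intro i hi j hj
    rw [Finset.mem_range] at hi hj
    rw [val_skew_left t hi, val_skew_right s t j hj, if_pos]
    have := val_lt t hj
    omega
  have h3 : ∀ i ∈ Finset.range t.size, ∀ j ∈ Finset.range s.size,
      (if s.size + i < j ∧ (skew s t).val j < (skew s t).val (s.size + i) then 1 else 0) = 0 := by
    intro i hi j hj
    rw [Finset.mem_range] at hi hj
    rw [if_neg]; omega
  have h4 : ∀ i ∈ Finset.range t.size, ∀ j ∈ Finset.range t.size,
      (if s.size + i < s.size + j ∧ (skew s t).val (s.size + j) < (skew s t).val (s.size + i)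
        then 1 else 0) = if i < j ∧ t.val j < t.val i then 1 else 0 := by
    intro i hi j hj
    rw [val_skew_right s t _ (Finset.mem_range.1 hi), val_skew_right s t _ (Finset.mem_range.1 hj)]
    simp
  rw [Finset.sum_congr rfl fun i hi => Finset.sum_congr rfl (h1 i hi),
    Finset.sum_congr rfl fun i hi => Finset.sum_congr rfl (h2 i hi),
    Finset.sum_congr rfl fun i hi => Finset.sum_congr rfl (h3 i hi),
    Finset.sum_congr rfl fun i hi => Finset.sum_congr rfl (h4 i hi)]
  simp
  ring

theorem invs_inv (t : SizedPerm) : invs t.inv = invs t := by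
  obtain ⟨n, π⟩ := t
  change inversions π⁻¹ = inversions π
  unfold inversions
  refine Finset.card_bij' (fun p _ => (π⁻¹ p.2, π⁻¹ p.1)) (fun p _ => (π p.2, π p.1)) ?_ ?_ ?_ ?_
  · intro p hp
    simpa [and_comm] using hp
  · intro p hp
    simpa [and_comm] using hp
  · intro p _; simp
  · intro p _; simp

/-- Up to parity, an arch has one inversion for each of the `α.size + 1` transpositions that
exchange its two outer summands, and those of `β`. -/
theorem pow_invs_arch {ε : ℂ} (hε : ε ^ 2 = 1) (α β : SizedPerm) :
    ε ^ invs (arch α β) = ε * (ε ^ α.size * ε ^ invs β) := by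
  have h : invs (arch α β) = α.size + 1 + invs β
      + 2 * (invs α + (α.size + 1) * β.size + α.size * (α.size + 1) / 2) := by
    have := Nat.two_mul_div_two_of_even (Nat.even_mul_succ_self α.size)
    rw [arch, invs_skew, invs_skew, invs_snoc, invs_snoc, invs_inv]
    simp only [size_skew, size_snoc, size_inv]
    nlinarith
  rw [h, pow_add, pow_mul, hε, one_pow, pow_add, pow_add]
  ring

end SizedPerm

/-! ### Generating functions of weighted sets -/

open PowerSeries

/-- The generating function `∑ w(a) X ^ s(a)`, the sum running over `a ∈ A`. -/
noncomputable def gf {α : Type*} (A : Set α) (s : α → ℕ) (w : α → ℂ) : PowerSeries ℂ :=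
  PowerSeries.mk fun n => ∑ᶠ a ∈ A ∩ s ⁻¹' {n}, w a

/-- There are finitely many objects of each size. -/
def FiniteFibers {α : Type*} (s : α → ℕ) : Prop := ∀ n, (s ⁻¹' {n}).Finite

theorem gf_congr {α : Type*} {A : Set α} {s s' : α → ℕ} {w w' : α → ℂ}
    (hs : ∀ a ∈ A, s a = s' a) (hw : ∀ a ∈ A, w a = w' a) : gf A s w = gf A s' w' := by
  ext n
  simp only [gf, coeff_mk]
  have h : A ∩ s ⁻¹' {n} = A ∩ s' ⁻¹' {n} := by
    ext a
    simp only [Set.mem_inter_iff, Set.mem_preimage, Set.mem_singleton_iff]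
    exact and_congr_right fun ha => by rw [hs a ha]
  rw [h]
  exact finsum_mem_congr rfl fun a ha => hw a ha.1

theorem gf_union {α : Type*} {A B : Set α} {s : α → ℕ} (hs : FiniteFibers s) (h : Disjoint A B)
    (w : α → ℂ) : gf (A ∪ B) s w = gf A s w + gf B s w := by
  ext n
  simp only [gf, coeff_mk, map_add, Set.union_inter_distrib_right]
  exact finsum_mem_union (h.mono Set.inter_subset_left Set.inter_subset_left)
    ((hs n).inter_of_right _) ((hs n).inter_of_right _)

theorem gf_diff {α : Type*} {A B : Set α} {s : α → ℕ} (hs : FiniteFibers s) (h : B ⊆ A)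
    (w : α → ℂ) : gf (A \ B) s w = gf A s w - gf B s w := by
  rw [eq_sub_iff_add_eq, ← gf_union hs Set.disjoint_sdiff_left, Set.sdiff_union_of_subset h]

theorem gf_image {α β : Type*} {A : Set α} {φ : α → β} (h : Function.Injective φ) (s : β → ℕ)
    (w : β → ℂ) : gf (φ '' A) s w = gf A (s ∘ φ) (w ∘ φ) := by
  ext n
  simp only [gf, coeff_mk]
  rw [Set.preimage_comp, ← Set.image_inter_preimage, finsum_mem_image h.injOn]
  rfl

theorem gf_singleton {α : Type*} {a : α} {s : α → ℕ} {w : α → ℂ} (hs : s a = 0) (hw : w a = 1) :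
    gf {a} s w = 1 := by
  ext n
  simp only [gf, coeff_mk, coeff_one]
  split_ifs with h
  · rw [Set.inter_eq_left.2, finsum_mem_singleton, hw]
    simp [hs, h]
  · rw [(_ : {a} ∩ s ⁻¹' {n} = ∅), finsum_mem_empty]
    ext b
    simp only [Set.mem_inter_iff, Set.mem_singleton_iff, Set.mem_preimage, Set.mem_empty_iff_false,
      iff_false]
    rintro ⟨rfl, hb⟩
    omega

theorem gf_empty {α : Type*} (s : α → ℕ) (w : α → ℂ) : gf ∅ s w = 0 := by
  ext n; simp [gf]

theorem gf_const_mul {α : Type*} (A : Set α) (s : α → ℕ) (c : ℂ) (w : α → ℂ) :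
    gf A s (fun a => c * w a) = PowerSeries.C c * gf A s w := by
  ext n
  rw [coeff_C_mul]
  simp only [gf, coeff_mk]
  exact (mul_finsum_mem _ _).symm

theorem gf_size_succ {α : Type*} (A : Set α) (s : α → ℕ) (w : α → ℂ) :
    gf A (fun a => s a + 1) w = X * gf A s w := by
  ext n
  obtain _ | n := n
  · simp [gf, Set.preimage]
  · rw [coeff_succ_X_mul]
    simp [gf, Set.preimage]

theorem gf_prod {α β : Type*} {A : Set α} {B : Set β} {s : α → ℕ} {s' : β → ℕ}
    (hs : FiniteFibers s) (hs' : FiniteFibers s') (w : α → ℂ) (w' : β → ℂ) :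
    gf (A ×ˢ B) (fun p => s p.1 + s' p.2) (fun p => w p.1 * w' p.2) = gf A s w * gf B s' w' := by
  classical
  ext n
  have hA : ∀ n, (A ∩ s ⁻¹' {n}).Finite := fun n => (hs n).inter_of_right _
  have hB : ∀ n, (B ∩ s' ⁻¹' {n}).Finite := fun n => (hs' n).inter_of_right _
  rw [coeff_mul]
  simp only [gf, coeff_mk]
  have hset : A ×ˢ B ∩ (fun p : α × β => s p.1 + s' p.2) ⁻¹' {n}
      = ((Finset.HasAntidiagonal.antidiagonal n).biUnion fun ij =>
          (hA ij.1).toFinset ×ˢ (hB ij.2).toFinset : Finset (α × β)) := by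
    ext p
    simp only [Set.mem_inter_iff, Set.mem_prod, Set.mem_preimage, Set.mem_singleton_iff,
      Finset.coe_biUnion, Set.mem_iUnion, Finset.mem_coe, Finset.HasAntidiagonal.mem_antidiagonal,
      Finset.mem_product, Set.Finite.mem_toFinset, Prod.exists]
    constructor
    · rintro ⟨⟨h1, h2⟩, h⟩
      exact ⟨s p.1, s' p.2, h, ⟨h1, rfl⟩, ⟨h2, rfl⟩⟩
    · rintro ⟨i, j, h, ⟨h1, rfl⟩, ⟨h2, rfl⟩⟩
      exact ⟨⟨h1, h2⟩, h⟩
  rw [hset, finsum_mem_coe_finset, Finset.sum_biUnion]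
  · refine Finset.sum_congr rfl fun ij _ => ?_
    rw [finsum_mem_eq_finite_toFinset_sum _ (hA ij.1),
      finsum_mem_eq_finite_toFinset_sum _ (hB ij.2), Finset.sum_mul_sum, Finset.sum_product]
  · intro x _ y _ hxy
    rw [Function.onFun, Finset.disjoint_left]
    rintro p hp hq
    simp only [Finset.mem_product, Set.Finite.mem_toFinset, Set.mem_inter_iff, Set.mem_preimage,
      Set.mem_singleton_iff] at hp hq
    exact hxy (Prod.ext (hp.1.2.symm.trans hq.1.2) (hp.2.2.symm.trans hq.2.2))

open SizedPerm

theorem finiteFibers_size : FiniteFibers SizedPerm.size := fun n => by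
  refine (Set.finite_range (ofPerm (n := n))).subset ?_
  rintro ⟨m, π⟩ h
  obtain rfl : m = n := h
  exact ⟨π, rfl⟩

theorem finiteFibers_two_mul_size : FiniteFibers fun t : SizedPerm => 2 * t.size := fun n =>
  (finiteFibers_size (n / 2)).subset fun t ht => by
    simp only [Set.mem_preimage, Set.mem_singleton_iff] at ht ⊢
    omega

/-! ### Recurrences for the generating functions -/

/-- The permutations avoiding `132` and `12…r`. -/
def permAvoiders (r : ℕ) : Set SizedPerm := {t | ¬ Has132 t ∧ ¬ HasInc t r}

/-- The involutions avoiding `132` and `12…m`. -/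
def incAvoiders (m : ℕ) : Set SizedPerm := {t | IsInvol t ∧ ¬ Has132 t ∧ ¬ HasInc t m}

/-- The involutions avoiding `132` and `(12…p) ⊖ (12…q)`. -/
def rotAvoiders (p q : ℕ) : Set SizedPerm := {t | IsInvol t ∧ ¬ Has132 t ∧ ¬ HasRot t p q}

/-- The generating function of `permAvoiders r` in the variable `ε X ^ 2`. -/
noncomputable def permGF (ε : ℂ) (r : ℕ) : PowerSeries ℂ :=
  gf (permAvoiders r) (fun t => 2 * t.size) fun t => ε ^ t.size

/-- The generating function of a set of permutations, each inversion having weight `ε`. For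
`ε = -1` this is the signed generating function. -/
noncomputable def invGF (ε : ℂ) (A : Set SizedPerm) : PowerSeries ℂ :=
  gf A SizedPerm.size fun t => ε ^ t.invs

theorem permAvoiders_zero : permAvoiders 0 = ∅ := by
  ext t; simp [permAvoiders, hasInc_zero]

theorem incAvoiders_zero : incAvoiders 0 = ∅ := by
  ext t; simp [incAvoiders, hasInc_zero]

theorem permAvoiders_mono {r r' : ℕ} (h : r ≤ r') : permAvoiders r ⊆ permAvoiders r' :=
  fun _ ht => ⟨ht.1, fun hi => ht.2 (hi.mono h)⟩

theorem permAvoiders_succ (r : ℕ) : permAvoiders (r + 1) =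
    {empty} ∪ (fun p : SizedPerm × SizedPerm => glue p.1 p.2) ''
      (permAvoiders r ×ˢ permAvoiders (r + 1)) := by
  ext t
  constructor
  · rintro ⟨h1, h2⟩
    by_cases h0 : t.size = 0
    · exact Or.inl (eq_empty h0)
    · obtain ⟨a, b, rfl⟩ := exists_glue h1 h0
      rw [has132_glue] at h1
      rw [hasInc_glue] at h2
      push Not at h1 h2
      exact Or.inr ⟨(a, b), ⟨⟨h1.1, h2.1⟩, ⟨h1.2, h2.2⟩⟩, rfl⟩
  · rintro (rfl | ⟨⟨a, b⟩, ⟨⟨h1, h2⟩, ⟨h3, h4⟩⟩, rfl⟩)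
    · exact ⟨not_has132_empty, not_hasInc_empty r⟩
    · exact ⟨by rw [has132_glue]; tauto, by rw [hasInc_glue]; tauto⟩

theorem incAvoiders_succ (m : ℕ) : incAvoiders (m + 1) =
    {empty} ∪ (snoc '' incAvoiders m ∪ (fun p : SizedPerm × SizedPerm => arch p.1 p.2) ''
      (permAvoiders m ×ˢ incAvoiders (m + 1))) := by
  ext t
  constructor
  · rintro ⟨hI, h1, h2⟩
    by_cases h0 : t.size = 0
    · exact Or.inl (eq_empty h0)
    · rcases exists_snoc_or_arch h1 hI h0 with ⟨s, rfl⟩ | ⟨α, β, rfl⟩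
      · rw [isInvol_snoc] at hI
        rw [has132_snoc] at h1
        rw [hasInc_snoc] at h2
        exact Or.inr (Or.inl ⟨s, ⟨hI, h1, h2⟩, rfl⟩)
      · rw [isInvol_arch] at hI
        rw [has132_arch] at h1
        rw [hasInc_arch] at h2
        push Not at h1 h2
        exact Or.inr (Or.inr ⟨(α, β), ⟨⟨h1.1, h2.1⟩, ⟨hI, h1.2, h2.2⟩⟩, rfl⟩)
  · rintro (rfl | ⟨s, ⟨hI, h1, h2⟩, rfl⟩ | ⟨⟨α, β⟩, ⟨⟨h1, h2⟩, ⟨hI, h3, h4⟩⟩, rfl⟩)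
    · exact ⟨isInvol_empty, not_has132_empty, not_hasInc_empty m⟩
    · exact ⟨isInvol_snoc.2 hI, by rwa [has132_snoc], by rwa [hasInc_snoc]⟩
    · exact ⟨isInvol_arch.2 hI, by rw [has132_arch]; tauto, by rw [hasInc_arch]; tauto⟩

/-- An arch over `β` avoids the pattern in two ways: either `α` is so short that only an occurrence
within `β` matters, or `β` has to avoid `12…(m+1)`, and with it the pattern. -/
theorem rotAvoiders_succ {m e : ℕ} (he : e ≤ m) : rotAvoiders (m + 1) (e + 1) =
    {empty} ∪ (snoc '' rotAvoiders (m + 1) (e + 1) ∪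
      (fun p : SizedPerm × SizedPerm => arch p.1 p.2) ''
        (permAvoiders e ×ˢ rotAvoiders (m + 1) (e + 1) ∪
          (permAvoiders m \ permAvoiders e) ×ˢ incAvoiders (m + 1))) := by
  ext t
  constructor
  · rintro ⟨hI, h1, h2⟩
    by_cases h0 : t.size = 0
    · exact Or.inl (eq_empty h0)
    · rcases exists_snoc_or_arch h1 hI h0 with ⟨s, rfl⟩ | ⟨α, β, rfl⟩
      · rw [isInvol_snoc] at hI
        rw [has132_snoc] at h1
        rw [hasRot_snoc (by omega) (by omega)] at h2
        exact Or.inr (Or.inl ⟨s, ⟨hI, h1, h2⟩, rfl⟩)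
      · rw [isInvol_arch] at hI
        rw [has132_arch] at h1
        rw [hasRot_arch he] at h2
        push Not at h1 h2
        refine Or.inr (Or.inr ⟨(α, β), ?_, rfl⟩)
        by_cases hα : HasInc α e
        · exact Or.inr ⟨⟨⟨h1.1, h2.1⟩, fun h => h.2 hα⟩, ⟨hI, h1.2, fun h => h2.2.2 h hα⟩⟩
        · exact Or.inl ⟨⟨h1.1, hα⟩, ⟨hI, h1.2, h2.2.1⟩⟩
  · rintro (rfl | ⟨s, ⟨hI, h1, h2⟩, rfl⟩ | ⟨⟨α, β⟩,
      (⟨⟨h1, h2⟩, ⟨hI, h3, h4⟩⟩ | ⟨⟨⟨h1, h2⟩, -⟩, ⟨hI, h3, h4⟩⟩), rfl⟩)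
    · exact ⟨isInvol_empty, not_has132_empty, fun h => not_hasInc_empty m h.hasInc⟩
    · exact ⟨isInvol_snoc.2 hI, by rwa [has132_snoc], by rwa [hasRot_snoc (by omega) (by omega)]⟩
    · refine ⟨isInvol_arch.2 hI, by rw [has132_arch]; tauto, ?_⟩
      rw [hasRot_arch he]
      have : HasInc α m → HasInc α e := fun h => h.mono he
      tauto
    · refine ⟨isInvol_arch.2 hI, by rw [has132_arch]; tauto, ?_⟩
      rw [hasRot_arch he]
      have : HasRot β (m + 1) (e + 1) → HasInc β (m + 1) := fun h => h.hasInc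
      tauto

theorem permGF_zero (ε : ℂ) : permGF ε 0 = 0 := by
  rw [permGF, permAvoiders_zero, gf_empty]

theorem invGF_empty (ε : ℂ) : invGF ε ∅ = 0 := gf_empty _ _

theorem permGF_succ (ε : ℂ) (r : ℕ) :
    permGF ε (r + 1) = 1 + C ε * X ^ 2 * (permGF ε r * permGF ε (r + 1)) := by
  conv_lhs => rw [permGF, permAvoiders_succ]
  rw [gf_union finiteFibers_two_mul_size, gf_singleton (by simp) (by simp), gf_image]
  · rw [gf_congr (s' := fun p => 2 * p.1.size + 2 * p.2.size + 1 + 1)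
      (w' := fun p => ε * (ε ^ p.1.size * ε ^ p.2.size)), gf_size_succ, gf_size_succ, gf_const_mul,
      gf_prod finiteFibers_two_mul_size finiteFibers_two_mul_size (fun t => ε ^ t.size)
        (fun t => ε ^ t.size)]
    · unfold permGF; ring
    · intro p _; simp only [Function.comp, size_glue]; ring
    · intro p _; simp only [Function.comp, size_glue]; ring
  · intro p q h
    exact Prod.ext (glue_injective h).1 (glue_injective h).2
  · rw [Set.disjoint_left]
    rintro _ rfl ⟨p, -, h⟩
    have := congrArg SizedPerm.size h
    simp at this

theorem injective_arch : Function.Injective fun p : SizedPerm × SizedPerm => arch p.1 p.2 :=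
  fun _ _ h => Prod.ext (arch_injective h).1 (arch_injective h).2

theorem invGF_arch {ε : ℂ} (hε : ε ^ 2 = 1) (A B : Set SizedPerm) :
    invGF ε ((fun p : SizedPerm × SizedPerm => arch p.1 p.2) '' (A ×ˢ B)) =
      C ε * X ^ 2 * (gf A (fun t => 2 * t.size) (fun t => ε ^ t.size) * invGF ε B) := by
  rw [invGF, gf_image injective_arch, gf_congr (s' := fun p => 2 * p.1.size + p.2.size + 1 + 1)
    (w' := fun p => ε * (ε ^ p.1.size * ε ^ p.2.invs)), gf_size_succ, gf_size_succ, gf_const_mul,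
    gf_prod finiteFibers_two_mul_size finiteFibers_size (fun t => ε ^ t.size)
      (fun t => ε ^ t.invs)]
  · unfold invGF; ring
  · intro p _; simp only [Function.comp, size_arch]; ring
  · intro p _; exact pow_invs_arch hε p.1 p.2

theorem invGF_snoc (ε : ℂ) (A : Set SizedPerm) : invGF ε (snoc '' A) = X * invGF ε A := by
  rw [invGF, gf_image fun _ _ h => snoc_injective h]
  refine Eq.trans ?_ (gf_size_succ _ _ _)
  exact gf_congr (fun _ _ => rfl) fun t _ => by simp only [Function.comp, invs_snoc]

theorem invGF_decomp (ε : ℂ) (A : Set SizedPerm) (P : Set (SizedPerm × SizedPerm)) :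
    invGF ε ({empty} ∪ (snoc '' A ∪ (fun p => arch p.1 p.2) '' P)) =
      1 + (X * invGF ε A + invGF ε ((fun p => arch p.1 p.2) '' P)) := by
  rw [← invGF_snoc, invGF, gf_union finiteFibers_size, gf_singleton (by simp) (by simp [invs_empty]),
    gf_union finiteFibers_size]
  · rfl
  · rw [Set.disjoint_left]
    rintro _ ⟨s, -, rfl⟩ ⟨p, -, h⟩
    -- the largest letter comes last in a `snoc` and not in an `arch`
    have h1 := congrArg SizedPerm.size h
    simp only [size_arch, size_snoc] at h1
    have h2 : (snoc s).val s.size = s.size := by rw [val_snoc, val_of_le le_rfl]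
    have h3 : (arch p.1 p.2).val p.1.size = s.size := by
      rw [val_arch_left _ le_rfl, val_of_le le_rfl]; omega
    have h4 : (snoc s).val p.1.size = s.size := by rw [← h3, ← h]
    have := val_inj _ (h2.trans h4.symm)
    omega
  · rw [Set.disjoint_left]
    rintro _ rfl (⟨s, -, h⟩ | ⟨p, -, h⟩)
    · have := congrArg SizedPerm.size h
      simp at this
    · have := congrArg SizedPerm.size h
      simp at this

theorem invGF_incAvoiders_succ {ε : ℂ} (hε : ε ^ 2 = 1) (m : ℕ) :
    invGF ε (incAvoiders (m + 1)) = 1 + (X * invGF ε (incAvoiders m) +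
      C ε * X ^ 2 * (permGF ε m * invGF ε (incAvoiders (m + 1)))) := by
  conv_lhs => rw [incAvoiders_succ, invGF_decomp, invGF_arch hε]
  rfl

theorem invGF_rotAvoiders_succ {ε : ℂ} (hε : ε ^ 2 = 1) {m e : ℕ} (he : e ≤ m) :
    invGF ε (rotAvoiders (m + 1) (e + 1)) = 1 + (X * invGF ε (rotAvoiders (m + 1) (e + 1)) +
      C ε * X ^ 2 * (permGF ε e * invGF ε (rotAvoiders (m + 1) (e + 1)) +
        (permGF ε m - permGF ε e) * invGF ε (incAvoiders (m + 1)))) := by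
  conv_lhs => rw [rotAvoiders_succ he, invGF_decomp, Set.image_union, invGF,
    invGF, gf_union finiteFibers_size ((Set.disjoint_image_iff injective_arch).2
      (Set.disjoint_prod.2 (Or.inl Set.disjoint_sdiff_right)))]
  have h1 := invGF_arch hε (permAvoiders e) (rotAvoiders (m + 1) (e + 1))
  have h2 := invGF_arch hε (permAvoiders m \ permAvoiders e) (incAvoiders (m + 1))
  rw [gf_diff finiteFibers_two_mul_size (permAvoiders_mono he)] at h2
  rw [invGF] at h1 h2
  rw [h1, h2]
  unfold permGF invGF
  ring

/-! ### Series of avoiding involutions -/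

theorem avoidingInvolutions_increasing (m n : ℕ) :
    avoidingInvolutions (increasing m) n = ofPerm ⁻¹' incAvoiders m := by
  ext π
  simp [avoidingInvolutions, incAvoiders, isInvol_iff, contains_pattern132, contains_increasing]

theorem avoidingInvolutions_rotated {k d : ℕ} (h : d ≤ k) (n : ℕ) :
    avoidingInvolutions (rotated k d) n = ofPerm ⁻¹' rotAvoiders (k - d) d := by
  ext π
  simp [avoidingInvolutions, rotAvoiders, isInvol_iff, contains_pattern132, contains_rotated _ h]

theorem coeff_invGF (ε : ℂ) (A : Set SizedPerm) (n : ℕ) :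
    coeff n (invGF ε A) = ∑ᶠ π ∈ (ofPerm ⁻¹' A : Set (Equiv.Perm (Fin n))),
      ε ^ inversions π := by
  rw [invGF, gf, coeff_mk]
  have h : A ∩ SizedPerm.size ⁻¹' {n} = ofPerm '' (ofPerm ⁻¹' A : Set (Equiv.Perm (Fin n))) := by
    ext ⟨m, π⟩
    constructor
    · rintro ⟨h1, h2⟩
      obtain rfl : m = n := h2
      exact ⟨π, h1, rfl⟩
    · rintro ⟨σ, h1, h2⟩
      rw [← h2]
      exact ⟨h1, rfl⟩
  rw [h, finsum_mem_image (sigma_mk_injective (i := n)).injOn]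
  rfl

theorem genI_eq {k : ℕ} {τ : Equiv.Perm (Fin k)} {A : Set SizedPerm}
    (h : ∀ n, avoidingInvolutions τ n = ofPerm ⁻¹' A) : genI τ = ofSeries (invGF 1 A) := by
  unfold genI
  congr 1
  ext n
  rw [coeff_mk, coeff_invGF, h]
  simp only [one_pow]
  rw [finsum_mem_eq_finite_toFinset_sum _ (Set.toFinite _), Finset.sum_const, nsmul_one,
    Set.ncard_eq_toFinset_card _ (Set.toFinite _)]

theorem genIe_eq {k : ℕ} {τ : Equiv.Perm (Fin k)} {A : Set SizedPerm}
    (h : ∀ n, avoidingInvolutions τ n = ofPerm ⁻¹' A) :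
    2 * genIe τ = ofSeries (invGF 1 A) + ofSeries (invGF (-1) A) := by
  classical
  unfold genIe ofSeries
  rw [← map_add, ← map_ofNat (algebraMap (PowerSeries ℂ) LaurentField) 2, ← map_mul]
  congr 1
  ext n
  rw [map_add, coeff_invGF, coeff_invGF, ← h, two_mul, map_add, coeff_mk, ← two_mul,
    finsum_mem_eq_finite_toFinset_sum _ (Set.toFinite _),
    finsum_mem_eq_finite_toFinset_sum _ (Set.toFinite _), ← Finset.sum_add_distrib,
    Set.ncard_eq_toFinset_card _ (Set.toFinite _)]
  have hf : (Set.toFinite {π ∈ avoidingInvolutions τ n | Even (inversions π)}).toFinset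
      = (Set.toFinite (avoidingInvolutions τ n)).toFinset.filter
        fun π => Even (inversions π) := by
    ext π; simp
  rw [hf, Finset.card_filter, Nat.cast_sum, Finset.mul_sum]
  refine Finset.sum_congr rfl fun π _ => ?_
  split_ifs with hπ
  · rw [hπ.neg_one_pow, one_pow]; norm_num
  · rw [(Nat.not_even_iff_odd.1 hπ).neg_one_pow, one_pow]; norm_num

/-! ### Chebyshev polynomials -/

theorem ofSeries_ne_zero {f : PowerSeries ℂ} (h : f ≠ 0) : ofSeries f ≠ 0 :=
  (map_ne_zero_iff _ (IsFractionRing.injective (PowerSeries ℂ) LaurentField)).2 h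

theorem x_ne_zero : x ≠ 0 := ofSeries_ne_zero X_ne_zero

/-- The recurrence `permGF_succ` in the field. -/
theorem ofSeries_permGF_succ_mul (ε : ℂ) (r : ℕ) :
    ofSeries (permGF ε (r + 1)) *
      (1 - algebraMap ℂ LaurentField ε * x ^ 2 * ofSeries (permGF ε r)) = 1 := by
  have h : permGF ε (r + 1) * (1 - C ε * X ^ 2 * permGF ε r) = 1 := by
    linear_combination permGF_succ ε r
  have := congrArg (algebraMap (PowerSeries ℂ) LaurentField) h
  simpa [ofSeries, x, IsScalarTower.algebraMap_apply ℂ (PowerSeries ℂ) LaurentField,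
    PowerSeries.algebraMap_apply] using this

/-- Both the quotients of Chebyshev polynomials and the generating functions `permGF ε r` satisfy
`f (r + 1) * (1 - s ^ 2 * f r) = 1`. The generating functions show that no denominator vanishes. -/
theorem eval_U_ne_zero_and_chebQuot_eq {ε : ℂ} {s : LaurentField} (hs0 : s ≠ 0)
    (hs : s ^ 2 = algebraMap ℂ LaurentField ε * x ^ 2) (r : ℕ) :
    (Polynomial.Chebyshev.U LaurentField (r : ℤ)).eval (1 / (2 * s)) ≠ 0 ∧
      chebQuot r s = ofSeries (permGF ε r) := by
  induction r with
  | zero => simp [chebQuot, permGF_zero, ofSeries]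
  | succ r ih =>
    obtain ⟨h1, h2⟩ := ih
    have h3 := ofSeries_permGF_succ_mul ε r
    rw [← hs, ← h2] at h3
    have h4 : s * (Polynomial.Chebyshev.U LaurentField ((r + 1 : ℕ) : ℤ)).eval (1 / (2 * s)) =
        (Polynomial.Chebyshev.U LaurentField (r : ℤ)).eval (1 / (2 * s)) *
          (1 - s ^ 2 * chebQuot r s) := by
      push_cast
      rw [Polynomial.Chebyshev.U_add_one, chebQuot]
      simp only [Polynomial.eval_sub, Polynomial.eval_mul, Polynomial.eval_ofNat,
        Polynomial.eval_X]
      generalize (Polynomial.Chebyshev.U LaurentField (r : ℤ)).eval (1 / (2 * s)) = u at h1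
      generalize (Polynomial.Chebyshev.U LaurentField ((r : ℤ) - 1)).eval (1 / (2 * s)) = v
      field_simp
    have h5 : 1 - s ^ 2 * chebQuot r s ≠ 0 := right_ne_zero_of_mul_eq_one h3
    have h6 : s * (Polynomial.Chebyshev.U LaurentField ((r + 1 : ℕ) : ℤ)).eval (1 / (2 * s)) ≠ 0 := by
      rw [h4]; exact mul_ne_zero h1 h5
    refine ⟨right_ne_zero_of_mul h6, ?_⟩
    rw [chebQuot, h4, Nat.cast_succ, add_sub_cancel_right, div_eq_iff (mul_ne_zero h1 h5)]
    linear_combination -(Polynomial.Chebyshev.U LaurentField (r : ℤ)).eval (1 / (2 * s)) * h3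

theorem eval_U_ne_zero (r : ℕ) :
    (Polynomial.Chebyshev.U LaurentField (r : ℤ)).eval (1 / (2 * x)) ≠ 0 :=
  (eval_U_ne_zero_and_chebQuot_eq x_ne_zero (ε := 1) (by simp) r).1

theorem R_x_sq (r : ℕ) : R r (x ^ 2) = ofSeries (permGF 1 r) := by
  rw [R_sq]
  exact (eval_U_ne_zero_and_chebQuot_eq x_ne_zero (ε := 1) (by simp) r).2

theorem R_neg_x_sq_eq (r : ℕ) : R r (-x ^ 2) = ofSeries (permGF (-1) r) := by
  rw [R_neg_x_sq]
  refine (eval_U_ne_zero_and_chebQuot_eq (mul_ne_zero ?_ x_ne_zero) ?_ r).2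
  · exact (map_ne_zero _).2 Complex.I_ne_zero
  · rw [mul_pow, ← map_pow, Complex.I_sq]

theorem one_sub_x_mul_ne_zero (f : PowerSeries ℂ) : 1 - x * ofSeries f ≠ 0 := by
  have h : (1 : PowerSeries ℂ) - X * f ≠ 0 := fun h => by
    have := congrArg (constantCoeff (R := ℂ)) h
    simp at this
  simpa [ofSeries, x] using ofSeries_ne_zero h

theorem genI_increasing (m : ℕ) : genI (increasing m) =
    1 / (x * (Polynomial.Chebyshev.U LaurentField (m : ℤ)).eval (1 / (2 * x))) *
      ∑ j ∈ Finset.range m, (Polynomial.Chebyshev.U LaurentField (j : ℤ)).eval (1 / (2 * x)) := by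
  induction m with
  | zero =>
    rw [genI_eq (avoidingInvolutions_increasing 0), incAvoiders_zero, invGF_empty]
    simp [ofSeries]
  | succ m ih =>
    have hU := eval_U_ne_zero m
    have hU' := eval_U_ne_zero (m + 1)
    have hx := x_ne_zero
    have h1 := congrArg (algebraMap (PowerSeries ℂ) LaurentField)
      (invGF_incAvoiders_succ (ε := 1) (by simp) m)
    have h2 := ofSeries_permGF_succ_mul 1 m
    have h3 := R_x_sq (m + 1)
    rw [R_sq, chebQuot] at h3
    rw [genI_eq (avoidingInvolutions_increasing m)] at ih
    rw [genI_eq (avoidingInvolutions_increasing (m + 1)), Finset.sum_range_succ]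
    simp only [map_add, map_mul, map_one, map_pow, one_mul] at h1 h2
    change ofSeries _ = 1 + (x * ofSeries _ + x ^ 2 * (ofSeries _ * ofSeries _)) at h1
    have h4 : ofSeries (invGF 1 (incAvoiders (m + 1))) =
        ofSeries (permGF 1 (m + 1)) * (1 + x * ofSeries (invGF 1 (incAvoiders m))) := by
      linear_combination ofSeries (permGF 1 (m + 1)) * h1
        - ofSeries (invGF 1 (incAvoiders (m + 1))) * h2
    rw [h4, ← h3, ih]
    push_cast at hU' ⊢
    rw [add_sub_cancel_right]
    field_simp
    ring

/-- The recurrence `invGF_rotAvoiders_succ` in the field, solved for its unknown. -/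
theorem ofSeries_invGF_rotAvoiders {ε : ℂ} (hε : ε ^ 2 = 1) {m e : ℕ} (he : e ≤ m) :
    ofSeries (invGF ε (rotAvoiders (m + 1) (e + 1))) =
      ofSeries (permGF ε (e + 1)) / (1 - x * ofSeries (permGF ε (e + 1))) *
        (1 + algebraMap ℂ LaurentField ε * x ^ 2 * (ofSeries (permGF ε m) - ofSeries (permGF ε e)) *
          ofSeries (invGF ε (incAvoiders (m + 1)))) := by
  have h1 := congrArg (algebraMap (PowerSeries ℂ) LaurentField) (invGF_rotAvoiders_succ hε he)
  have h2 := ofSeries_permGF_succ_mul ε e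
  have hc : algebraMap (PowerSeries ℂ) LaurentField (C ε) = algebraMap ℂ LaurentField ε := by
    rw [IsScalarTower.algebraMap_apply ℂ (PowerSeries ℂ) LaurentField,
      PowerSeries.algebraMap_apply]; rfl
  simp only [map_add, map_sub, map_mul, map_one, map_pow, hc] at h1
  change ofSeries _ = 1 + (x * ofSeries _ + algebraMap ℂ LaurentField ε * x ^ 2 *
    (ofSeries _ * ofSeries _ + (ofSeries _ - ofSeries _) * ofSeries _)) at h1
  rw [div_mul_eq_mul_div, eq_div_iff (one_sub_x_mul_ne_zero _)]
  linear_combination ofSeries (permGF ε (e + 1)) * h1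
    - ofSeries (invGF ε (rotAvoiders (m + 1) (e + 1))) * h2

end RestrictedInvolutions

open RestrictedInvolutions in
theorem mainTheorem7 (k d : ℕ) (hd : 1 ≤ d) (hdk : 2 * d ≤ k) :
    genIe (rotated k d) =
        R d (-x ^ 2) / (1 - x * R d (-x ^ 2)) *
          (1 + x ^ 2 * (R (d - 1) (-x ^ 2) - R (k - d - 1) (-x ^ 2)) * genIe (increasing (k - d))
            + x ^ 2 * (Re (k - d - 1) (x ^ 2) - Re (d - 1) (x ^ 2)) * genI (increasing (k - d))
            + x ^ 2 * Re (d - 1) (x ^ 2) * genI (rotated k d)) ∧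
      genI (increasing (k - d)) =
        1 / (x * (Polynomial.Chebyshev.U LaurentField ((k - d : ℕ) : ℤ)).eval (1 / (2 * x))) *
          ∑ j ∈ Finset.range (k - d),
            (Polynomial.Chebyshev.U LaurentField (j : ℤ)).eval (1 / (2 * x)) ∧
      genI (rotated k d) =
        R d (x ^ 2) / (1 - x * R d (x ^ 2)) *
          (1 + x ^ 2 * (R (k - d - 1) (x ^ 2) - R (d - 1) (x ^ 2)) * genI (increasing (k - d))) := by
  obtain ⟨e, rfl⟩ : ∃ e, d = e + 1 := ⟨d - 1, by omega⟩
  obtain ⟨m, hm⟩ : ∃ m, k - (e + 1) = m + 1 := ⟨k - (e + 1) - 1, by omega⟩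
  have he : e ≤ m := by omega
  have hrot := avoidingInvolutions_rotated (k := k) (d := e + 1) (by omega)
  rw [hm] at hrot ⊢
  have hinc := avoidingInvolutions_increasing (m + 1)
  have hI := ofSeries_invGF_rotAvoiders (ε := 1) (by simp) he
  have hJ := ofSeries_invGF_rotAvoiders (ε := -1) (by simp) he
  rw [map_one, one_mul] at hI
  rw [map_neg, map_one, neg_one_mul] at hJ
  refine ⟨?_, genI_increasing (m + 1), ?_⟩
  · have h1 := genIe_eq hrot
    have h2 := genIe_eq hinc
    have h3 := ofSeries_permGF_succ_mul 1 e
    have h4 := ofSeries_permGF_succ_mul (-1) e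
    rw [map_one, one_mul] at h3
    rw [map_neg, map_one, neg_one_mul] at h4
    have hne := one_sub_x_mul_ne_zero (permGF 1 (e + 1))
    have hne' := one_sub_x_mul_ne_zero (permGF (-1) (e + 1))
    simp only [Re, R_x_sq, R_neg_x_sq_eq, Nat.add_sub_cancel, genI_eq hrot, genI_eq hinc]
    rw [div_mul_eq_mul_div, eq_div_iff hne] at hI
    rw [div_mul_eq_mul_div, eq_div_iff hne'] at hJ
    rw [div_mul_eq_mul_div, eq_div_iff hne']
    set I := ofSeries (invGF 1 (rotAvoiders (m + 1) (e + 1)))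
    set I' := ofSeries (invGF 1 (incAvoiders (m + 1)))
    set P := ofSeries (permGF 1 e)
    set P' := ofSeries (permGF 1 m)
    set M := ofSeries (permGF (-1) e)
    set M' := ofSeries (permGF (-1) m)
    set D := ofSeries (permGF (-1) (e + 1))
    have h5 : I * (1 - x ^ 2 * P - x) = 1 + x ^ 2 * (P' - P) * I' := by
      linear_combination (1 - x ^ 2 * P) * hI + (I * x + (1 + x ^ 2 * (P' - P) * I')) * h3
    -- the recurrence of the unsigned series, with the denominator of the signed one
    have h6 : I * (1 - x * D) = D * (1 + x ^ 2 * (P' - P) * I' + x ^ 2 * (M + P) * I) := by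
      linear_combination D * h5 - I * h4
    linear_combination (1 - x * D) / 2 * h1 + (h6 + hJ) / 2 - D * x ^ 2 * (M - M') / 2 * h2
  · simp only [R_x_sq, Nat.add_sub_cancel, genI_eq hrot, genI_eq hinc]
    exact hI
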